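/- Let $p_0,p_1$ be probability densities on $\mathbb{R}^d$ (with respect to Lebesgue measure), let $\alpha_t,\beta_t$ be real schedule values with $\alpha_t\neq 0$, and fix $t$ and $x_t\in\mathbb{R}^d$. Assume that $$Z=\int_{\mathbb{R}^d}p_0(x_0)\,p_1\!\left(\tfrac{1}{\alpha_t}x_t-\tfrac{\beta_t}{\alpha_t}x_0\right)dx_0\in(0,\infty),$$ and let $q(x_0)=q^*_{0\mid t}(x_0\mid x_t)=Z^{-1}p_0(x_0)\,p_1\!\left(\tfrac{1}{\alpha_t}x_t-\tfrac{\beta_t}{\alpha_t}x_0\right)$ be the noise posterior density. Assume that $q$ is continuously differentiable and has a finite first moment, and put $\mu_{0\mid t}(x_t)=\mathbb{E}_{X_0\sim q}[X_0]$. For a $C^1$ vector field $\phi:\mathbb{R}^d\to\mathbb{R}^d$ let $(\mathcal{T}_q\phi)(x)=\nabla\cdot\phi(x)+\phi(x)\cdot\nabla\log q(x)$ for all $x$ with $q(x)>0$, and for $\Phi=[\phi_1,\dots,\phi_d]:\mathbb{R}^d\to\mathbb{R}^{d\times d}$ with $C^1$ columns $\phi_j$ let $\mathcal{T}_{q,d}\Phi=(\mathcal{T}_q\phi_1,\dots,\mathcal{T}_q\phi_d)^\top$.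 Let $\Phi_t(\cdot,x_t):\mathbb{R}^d\to\mathbb{R}^{d\times d}$ be admissible, that is, each column $\phi_j$ is $C^1$ and satisfies $\mathbb{E}_{X\sim q}\left[|(\mathcal{T}_q\phi_j)(X)|\right]<\infty$ and $$\lim_{R\to\infty}\int_{\partial B_R}q(x)\,\phi_j(x)\cdot n(x)\,dS(x)=0,$$ where $B_R=\{x:\|x\|_2\le R\}$ and $n$ is the outward unit normal. Then the estimator $X_0+(\mathcal{T}_{q,d}\Phi_t(\cdot,x_t))(X_0)$, $X_0\sim q$, has zero variance (that is, the trace of its covariance matrix, the sum of the variances of its components, is $0$) if and only if $$(\mathcal{T}_{q,d}\Phi_t(\cdot,x_t))(x_0)=\mu_{0\mid t}(x_t)-x_0\qquad\text{for every }x_0\text{ in the support }\{x_0: q(x_0)>0\}\text{ of }q.$$ -/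

import Mathlib

open MeasureTheory ProbabilityTheory Filter Topology

noncomputable section

/-- `ℝ^d` with the Euclidean norm and inner product. -/
abbrev Eucl (d : ℕ) : Type := EuclideanSpace ℝ (Fin d)

/-- `p` is a probability density on `ℝ^d` with respect to Lebesgue measure. -/
structure IsProbDensity {d : ℕ} (p : Eucl d → ℝ) : Prop where
  measurable : Measurable p
  nonneg : ∀ x, 0 ≤ p x
  integrable : Integrable p volume
  integral_eq_one : ∫ x, p x = 1

/-- The law with Lebesgue density `p`. -/
def densityMeasure {d : ℕ} (p : Eucl d → ℝ) : Measure (Eucl d) :=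
  volume.withDensity (fun x => ENNReal.ofReal (p x))

/-- The unnormalized noise posterior `x₀ ↦ p₀(x₀) p₁(x_t / a - (b / a) x₀)`, for
schedule values `a = α_t`, `b = β_t` and the observation `xt = x_t`. -/
def noiseJoint {d : ℕ} (p₀ p₁ : Eucl d → ℝ) (a b : ℝ) (xt : Eucl d) (x₀ : Eucl d) : ℝ :=
  p₀ x₀ * p₁ ((1 / a) • xt - (b / a) • x₀)

/-- The noise posterior density `q*_{0|t}(· | x_t)`: the unnormalized noise posterior
divided by its total mass. -/
def noisePosterior {d : ℕ} (p₀ p₁ : Eucl d → ℝ) (a b : ℝ) (xt : Eucl d) (x₀ : Eucl d) : ℝ :=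
  noiseJoint p₀ p₁ a b xt x₀ / ∫ y, noiseJoint p₀ p₁ a b xt y

/-- The divergence `∑ᵢ ∂φᵢ/∂xᵢ` of a vector field on `ℝ^d`. -/
def divergence {d : ℕ} (φ : Eucl d → Eucl d) (x : Eucl d) : ℝ :=
  ∑ i : Fin d, (fderiv ℝ φ x (EuclideanSpace.single i 1)) i

/-- The Langevin Stein operator `(T_p φ)(x) = ∇·φ(x) + φ(x)·∇ log p(x)`. It has its meaning
at the points `x` with `p x > 0`. -/
def langevinStein {d : ℕ} (p : Eucl d → ℝ) (φ : Eucl d → Eucl d) (x : Eucl d) : ℝ :=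
  divergence φ x + inner ℝ (φ x) (gradient (fun y => Real.log (p y)) x)

/-- The flux `∫_{∂B_R} F·n dS` of the vector field `F` through the sphere of radius `R > 0`
around the origin, with outward unit normal `n`. The surface measure of the unit sphere is
`volume.toSphere`, and the sphere of radius `R` is parametrized by `ω ↦ R ω`, whose
surface element is `R^(d-1)` times that of the unit sphere and whose normal is `ω`. -/
def sphereFlux {d : ℕ} (F : Eucl d → Eucl d) (R : ℝ) : ℝ :=
  R ^ (d - 1) *
    ∫ ω : Metric.sphere (0 : Eucl d) 1,
      inner ℝ (F (R • (ω : Eucl d))) (ω : Eucl d) ∂(volume : Measure (Eucl d)).toSphere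

/-- The regularity, integrability and boundary conditions on a vector field `φ` under which
the Langevin Stein operator of the density `p` is applied: `φ` is `C¹`, `E_p |T_p φ| < ∞`,
and the flux of `p φ` through the sphere of radius `R` tends to `0` as `R → ∞`. -/
structure SteinAdmissible {d : ℕ} (p : Eucl d → ℝ) (φ : Eucl d → Eucl d) : Prop where
  contDiff : ContDiff ℝ 1 φ
  integrable : Integrable (langevinStein p φ) (densityMeasure p)
  boundary : Tendsto (fun R : ℝ => sphereFlux (fun x => p x • φ x) R) atTop (𝓝 0)

/-- The `j`-th column `φ_j` of a matrix-valued function `Φ = [φ_1, …, φ_m]`. -/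
def matrixColumn {d m : ℕ} (Φ : Eucl d → Matrix (Fin d) (Fin m) ℝ) (j : Fin m) :
    Eucl d → Eucl d :=
  fun x => WithLp.toLp 2 (fun i => Φ x i j)

/-- The generalized Langevin Stein operator `T_{p,m}`, acting on each column of `Φ`. -/
def genLangevinStein {d m : ℕ} (p : Eucl d → ℝ) (Φ : Eucl d → Matrix (Fin d) (Fin m) ℝ) :
    Eucl d → Eucl m :=
  fun x => WithLp.toLp 2 (fun j => langevinStein p (matrixColumn Φ j) x)

/-- A matrix-valued test function is admissible when each of its columns is. -/
def MatrixSteinAdmissible {d m : ℕ} (p : Eucl d → ℝ)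
    (Φ : Eucl d → Matrix (Fin d) (Fin m) ℝ) : Prop :=
  ∀ j : Fin m, SteinAdmissible p (matrixColumn Φ j)

/-- The total variance of a random vector `Y` under the law `ν`: the trace of the covariance
matrix, i.e. the sum of the variances of the components, with values in `[0, ∞]`. -/
def totalVariance {d m : ℕ} (ν : Measure (Eucl d)) (Y : Eucl d → Eucl m) : ENNReal :=
  ∑ j : Fin m, evariance (fun x => Y x j) ν

end

/-!
Write `q` for the noise posterior density. The heart of the matter is Stein's identity
`E_q[T_q φ] = 0` (`integral_langevinStein_eq_zero`): it makes the estimator `X₀ + T_q Φ(X₀)`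
unbiased for the posterior mean `μ`. A component of the estimator has variance `0` exactly when it
is almost surely equal to its expectation, which is thus the corresponding component of `μ`. Both
sides of that equation are continuous on the open set `{q > 0}`, where `q`-null open sets are
empty, so "almost surely" there means "everywhere" (`ae_densityMeasure_eq_iff`).

Stein's identity follows from the divergence form `q T_q φ = ∇·(q φ)` (`mul_langevinStein`) and
from the vanishing of `∫ ∇·F` for a `C¹` field `F` with integrable divergence whose flux through
large spheres tends to `0` (`integral_divergence_eq_zero`). The latter is proved without the
divergence theorem on balls: integrating `∇·F` by parts against a smooth radial cutoff `η`, and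
passing to polar coordinates, turns `∫ η ∇·F` into an average of the fluxes of `F` through the
spheres on which `η` is not locally constant. As the cutoff moves off to infinity, `∫ η ∇·F` tends
to `∫ ∇·F` and the averages tend to `0`.
-/

/-! ### Integration in polar coordinates and the divergence theorem at infinity -/

/-- Integration in polar coordinates, in the iterated form "spheres first". -/
theorem integral_eq_integral_Ioi_integral_sphere {d : ℕ} (hd : d ≠ 0) {f : Eucl d → ℝ}
    (hf : Integrable f volume) :
    ∫ x, f x = ∫ r in Set.Ioi (0 : ℝ), r ^ (d - 1) *
      ∫ ω : Metric.sphere (0 : Eucl d) 1, f (r • (ω : Eucl d))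
        ∂(volume : Measure (Eucl d)).toSphere := by
  have : NeZero d := ⟨hd⟩
  have hmp := (volume : Measure (Eucl d)).measurePreserving_homeomorphUnitSphereProd
  have hemb := (homeomorphUnitSphereProd (Eucl d)).measurableEmbedding
  have hcomp : ∀ x : ({(0)}ᶜ : Set (Eucl d)),
      f ((homeomorphUnitSphereProd (Eucl d) x).2.1 • (homeomorphUnitSphereProd (Eucl d) x).1.1)
        = f x.1 := by
    intro x
    have hx : ‖x.1‖ ≠ 0 := norm_ne_zero_iff.2 x.2
    simp [smul_smul, hx]
  have hint : Integrable (fun z : Metric.sphere (0 : Eucl d) 1 × Set.Ioi (0 : ℝ) =>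
      f (z.2.1 • z.1.1)) ((volume : Measure (Eucl d)).toSphere.prod
        (Measure.volumeIoiPow (Module.finrank ℝ (Eucl d) - 1))) := by
    rw [← hmp.integrable_comp_emb hemb]
    simp only [Function.comp_def, hcomp]
    rw [← Function.comp_def f, ← integrableOn_iff_comap_subtypeVal (by measurability)]
    exact hf.integrableOn
  calc ∫ x, f x = ∫ x : ({(0)}ᶜ : Set (Eucl d)), f x.1 ∂(Measure.comap Subtype.val volume) := by
        rw [integral_subtype_comap (measurableSet_singleton _).compl f,
          restrict_compl_singleton]
    _ = ∫ z : Metric.sphere (0 : Eucl d) 1 × Set.Ioi (0 : ℝ), f (z.2.1 • z.1.1)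
          ∂((volume : Measure (Eucl d)).toSphere.prod
            (Measure.volumeIoiPow (Module.finrank ℝ (Eucl d) - 1))) := by
        rw [← hmp.integral_comp hemb]
        simp only [hcomp]
    _ = ∫ r : Set.Ioi (0 : ℝ), (∫ ω : Metric.sphere (0 : Eucl d) 1, f (r.1 • (ω : Eucl d))
          ∂(volume : Measure (Eucl d)).toSphere) ∂(Measure.volumeIoiPow (d - 1)) := by
        rw [integral_prod_symm _ hint]
        simp
    _ = _ := by
        simp only [Measure.volumeIoiPow, ENNReal.ofReal]
        rw [integral_withDensity_eq_integral_smul,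
          integral_subtype_comap measurableSet_Ioi fun r : ℝ => Real.toNNReal (r ^ (d - 1)) •
            ∫ ω : Metric.sphere (0 : Eucl d) 1, f (r • (ω : Eucl d))
              ∂(volume : Measure (Eucl d)).toSphere]
        · refine setIntegral_congr_fun measurableSet_Ioi fun r hr => ?_
          simp only [NNReal.smul_def, smul_eq_mul]
          rw [Real.coe_toNNReal _ (pow_nonneg (le_of_lt hr) _)]
        · exact (measurable_subtype_coe.pow_const _).real_toNNReal

theorem continuous_divergence {d : ℕ} {F : Eucl d → Eucl d} (hF : ContDiff ℝ 1 F) :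
    Continuous (divergence F) := by
  have h := hF.continuous_fderiv (by norm_num)
  unfold divergence
  fun_prop

/-- Integration by parts: the divergence is minus the adjoint of the gradient. -/
theorem integral_mul_divergence {d : ℕ} {η : Eucl d → ℝ} {F : Eucl d → Eucl d}
    (hη : ContDiff ℝ 1 η) (hsupp : HasCompactSupport η) (hF : ContDiff ℝ 1 F) :
    ∫ x, η x * divergence F x = -∫ x, fderiv ℝ η x (F x) := by
  have hη' := hη.continuous_fderiv (by norm_num)
  have hF' := hF.continuous_fderiv (by norm_num)
  have hcont := hF.continuous
  have hηc := hη.continuous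
  have hsupp' : HasCompactSupport (fderiv ℝ η) := hsupp.fderiv ℝ
  have hI1 : ∀ i : Fin d,
      Integrable (fun x => η x * (fderiv ℝ F x (EuclideanSpace.single i 1)) i) := fun i =>
    Continuous.integrable_of_hasCompactSupport (by fun_prop) hsupp.mul_right
  have hs2 : ∀ i : Fin d,
      HasCompactSupport (fun x => fderiv ℝ η x (EuclideanSpace.single i 1)) := fun i =>
    hsupp'.comp_left (g := fun T : Eucl d →L[ℝ] ℝ => T (EuclideanSpace.single i 1)) rfl
  have hI2 : ∀ i : Fin d,
      Integrable (fun x => fderiv ℝ η x (EuclideanSpace.single i 1) * F x i) := fun i =>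
    Continuous.integrable_of_hasCompactSupport (by fun_prop) (hs2 i).mul_right
  have hI3 : ∀ i : Fin d, Integrable (fun x => η x * F x i) := fun i =>
    Continuous.integrable_of_hasCompactSupport (by fun_prop) hsupp.mul_right
  have hcoord : ∀ (i : Fin d) (x : Eucl d),
      HasFDerivAt (fun y => F y i) ((EuclideanSpace.proj i).comp (fderiv ℝ F x)) x := fun i x =>
    (EuclideanSpace.proj (𝕜 := ℝ) i).hasFDerivAt.comp x
      (hF.differentiable (by norm_num) x).hasFDerivAt
  have hparts : ∀ i : Fin d,
      ∫ x, η x * (fderiv ℝ F x (EuclideanSpace.single i 1)) i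
        = -∫ x, fderiv ℝ η x (EuclideanSpace.single i 1) * F x i := fun i =>
    integral_bilinear_hasFDerivAt_right_eq_neg_left_of_integrable
      (B := ContinuousLinearMap.mul ℝ ℝ) (v := EuclideanSpace.single i 1)
      (f := η) (f' := fderiv ℝ η) (g := fun x => F x i)
      (g' := fun x => (EuclideanSpace.proj i).comp (fderiv ℝ F x))
      (hI2 i) (hI1 i) (hI3 i)
      (fun x _ => (hη.differentiable (by norm_num) x).hasFDerivAt) (fun x _ => hcoord i x)
  have hexp : ∀ x, fderiv ℝ η x (F x)
      = ∑ i : Fin d, fderiv ℝ η x (EuclideanSpace.single i 1) * F x i := by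
    intro x
    conv_lhs => rw [← (EuclideanSpace.basisFun (Fin d) ℝ).sum_repr (F x)]
    simp [mul_comm]
  simp only [divergence, Finset.mul_sum, hexp]
  rw [integral_finsetSum _ fun i _ => hI1 i, integral_finsetSum _ fun i _ => hI2 i,
    ← Finset.sum_neg_distrib]
  exact Finset.sum_congr rfl fun i _ => hparts i

/-- A smooth radial cutoff function: it is `1` on the ball of radius `√c` and vanishes outside the
ball of radius `√(c + 1)`. Working with the square of the norm keeps it smooth at the origin. -/
noncomputable def radialCutoff {d : ℕ} (c : ℝ) (x : Eucl d) : ℝ :=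
  1 - Real.smoothTransition (‖x‖ ^ 2 - c)

theorem contDiff_radialCutoff {d : ℕ} (c : ℝ) : ContDiff ℝ 1 (radialCutoff (d := d) c) :=
  contDiff_const.sub
    ((Real.smoothTransition.contDiff (n := 1)).comp ((contDiff_norm_sq ℝ).sub contDiff_const))

theorem hasCompactSupport_radialCutoff {d : ℕ} (c : ℝ) :
    HasCompactSupport (radialCutoff (d := d) c) := by
  refine HasCompactSupport.intro (isCompact_closedBall 0 (1 + |c|)) fun x hx => ?_
  have hx' : 1 + |c| < ‖x‖ := by simpa using hx
  have : 1 ≤ ‖x‖ ^ 2 - c := by nlinarith [abs_nonneg c, le_abs_self c]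
  simp [radialCutoff, Real.smoothTransition.one_of_one_le this]

theorem abs_radialCutoff_le_one {d : ℕ} (c : ℝ) (x : Eucl d) : |radialCutoff c x| ≤ 1 := by
  have h0 := Real.smoothTransition.nonneg (‖x‖ ^ 2 - c)
  have h1 := Real.smoothTransition.le_one (‖x‖ ^ 2 - c)
  rw [radialCutoff, abs_le]
  constructor <;> linarith

theorem tendsto_radialCutoff {d : ℕ} (x : Eucl d) :
    Tendsto (fun n : ℕ => radialCutoff (n : ℝ) x) atTop (𝓝 1) := by
  refine tendsto_const_nhds.congr' ?_
  filter_upwards [eventually_ge_atTop ⌈‖x‖ ^ 2⌉₊] with n hn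
  have : ‖x‖ ^ 2 - (n : ℝ) ≤ 0 := sub_nonpos.2 (Nat.ceil_le.1 hn)
  simp [radialCutoff, Real.smoothTransition.zero_of_nonpos this]

theorem hasDerivAt_smoothTransition (s : ℝ) :
    HasDerivAt Real.smoothTransition (deriv Real.smoothTransition s) s :=
  ((Real.smoothTransition.contDiff (n := 1)).differentiable (by norm_num) s).hasDerivAt

theorem fderiv_radialCutoff {d : ℕ} (c : ℝ) (x v : Eucl d) :
    fderiv ℝ (radialCutoff c) x v
      = -(deriv Real.smoothTransition (‖x‖ ^ 2 - c) * (2 * inner ℝ x v)) := by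
  have h1 : HasFDerivAt (fun y : Eucl d => ‖y‖ ^ 2 - c) (2 • innerSL ℝ x) x :=
    (hasStrictFDerivAt_norm_sq x).hasFDerivAt.sub_const c
  have h2 := ((hasDerivAt_smoothTransition (‖x‖ ^ 2 - c)).comp_hasFDerivAt x h1).const_sub 1
  have h3 : HasFDerivAt (radialCutoff c)
      (-(deriv Real.smoothTransition (‖x‖ ^ 2 - c) • (2 • innerSL ℝ x))) x := h2
  rw [h3.fderiv]
  simp

theorem deriv_smoothTransition_eq_zero {s : ℝ} (hs : s ≤ 0) :
    deriv Real.smoothTransition s = 0 := by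
  refine IsLocalMin.deriv_eq_zero (Eventually.of_forall fun u => ?_)
  rw [Real.smoothTransition.zero_of_nonpos hs]
  exact Real.smoothTransition.nonneg u

/-- The radial derivative of `radialCutoff c` has total mass `1`, whatever `c ≥ 0`. -/
theorem integral_deriv_smoothTransition_sq {c : ℝ} (hc : 0 ≤ c) :
    IntegrableOn (fun r : ℝ => deriv Real.smoothTransition (r ^ 2 - c) * (2 * r)) (Set.Ioi 0) ∧
      ∫ r in Set.Ioi (0 : ℝ), deriv Real.smoothTransition (r ^ 2 - c) * (2 * r) = 1 := by
  have hder : ∀ r ∈ Set.Ici (0 : ℝ), HasDerivAt (fun r : ℝ => Real.smoothTransition (r ^ 2 - c))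
      (deriv Real.smoothTransition (r ^ 2 - c) * (2 * r)) r := by
    intro r _
    have h := (hasDerivAt_pow 2 r).sub_const c
    have := (hasDerivAt_smoothTransition (r ^ 2 - c)).comp r h
    simpa [Function.comp_def] using this
  have hnn : ∀ r ∈ Set.Ioi (0 : ℝ), 0 ≤ deriv Real.smoothTransition (r ^ 2 - c) * (2 * r) := by
    intro r hr
    have hr' : (0 : ℝ) < r := hr
    have := Real.smoothTransition.monotone.deriv_nonneg (x := r ^ 2 - c)
    positivity
  have hlim : Tendsto (fun r : ℝ => Real.smoothTransition (r ^ 2 - c)) atTop (𝓝 1) := by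
    refine tendsto_const_nhds.congr' ?_
    filter_upwards [eventually_ge_atTop (1 + c)] with r hr
    exact (Real.smoothTransition.one_of_one_le (by nlinarith)).symm
  refine ⟨integrableOn_Ioi_deriv_of_nonneg' hder hnn hlim, ?_⟩
  rw [integral_Ioi_of_hasDerivAt_of_nonneg' hder hnn hlim,
    Real.smoothTransition.zero_of_nonpos (by simpa using hc), sub_zero]

/-- Testing the divergence against a radial cutoff averages the flux over spheres. -/
theorem integral_radialCutoff_mul_divergence {d : ℕ} (hd : d ≠ 0) (c : ℝ) {F : Eucl d → Eucl d}
    (hF : ContDiff ℝ 1 F) :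
    ∫ x, radialCutoff c x * divergence F x
      = ∫ r in Set.Ioi (0 : ℝ),
          deriv Real.smoothTransition (r ^ 2 - c) * (2 * r) * sphereFlux F r := by
  have hη := contDiff_radialCutoff (d := d) c
  have hη' := hη.continuous_fderiv (by norm_num)
  have hFc := hF.continuous
  have hs := (hasCompactSupport_radialCutoff (d := d) c).fderiv ℝ
  have hint : Integrable (fun x => fderiv ℝ (radialCutoff c) x (F x)) := by
    refine Continuous.integrable_of_hasCompactSupport (by fun_prop) (hs.mono fun x hx h0 => hx ?_)
    simp [h0]
  rw [integral_mul_divergence hη (hasCompactSupport_radialCutoff c) hF,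
    integral_eq_integral_Ioi_integral_sphere hd hint, ← integral_neg]
  refine setIntegral_congr_fun measurableSet_Ioi fun r hr => ?_
  have hr' : (0 : ℝ) < r := hr
  have hpt : ∀ ω : Metric.sphere (0 : Eucl d) 1,
      fderiv ℝ (radialCutoff c) (r • (ω : Eucl d)) (F (r • (ω : Eucl d)))
        = -(deriv Real.smoothTransition (r ^ 2 - c) * (2 * r)) *
          inner ℝ (F (r • (ω : Eucl d))) (ω : Eucl d) := by
    intro ω
    have hn : ‖r • (ω : Eucl d)‖ = r := by simp [norm_smul, abs_of_pos hr']
    rw [fderiv_radialCutoff, hn, real_inner_smul_left, real_inner_comm]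
    ring
  simp only [hpt, integral_const_mul, sphereFlux]
  ring

/-- A `C¹` vector field with integrable divergence whose flux through large spheres tends to `0`
has divergence of total integral `0`. -/
theorem integral_divergence_eq_zero {d : ℕ} {F : Eucl d → Eucl d} (hF : ContDiff ℝ 1 F)
    (hint : Integrable (divergence F) volume)
    (hflux : Tendsto (sphereFlux F) atTop (𝓝 0)) :
    ∫ x, divergence F x = 0 := by
  rcases eq_or_ne d 0 with rfl | hd
  · simp [divergence]
  have hdiv := continuous_divergence hF
  have hlim1 : Tendsto (fun n : ℕ => ∫ x, radialCutoff (n : ℝ) x * divergence F x) atTop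
      (𝓝 (∫ x, divergence F x)) := by
    refine tendsto_integral_of_dominated_convergence (fun x => |divergence F x|) (fun n => ?_)
      hint.abs (fun n => ae_of_all _ fun x => ?_) (ae_of_all _ fun x => ?_)
    · exact ((contDiff_radialCutoff _).continuous.mul hdiv).aestronglyMeasurable
    · rw [Real.norm_eq_abs, abs_mul]
      exact mul_le_of_le_one_left (abs_nonneg _) (abs_radialCutoff_le_one _ x)
    · simpa using (tendsto_radialCutoff x).mul_const (divergence F x)
  refine tendsto_nhds_unique hlim1 (Metric.tendsto_atTop.2 fun ε hε => ?_)
  obtain ⟨R, hR⟩ := Metric.tendsto_atTop.1 hflux (ε / 2) (half_pos hε)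
  -- For `n ≥ R ^ 2` the cutoff is constant on the ball of radius `R`, so that only spheres of
  -- radius at least `R` contribute.
  refine ⟨⌈R ^ 2⌉₊, fun n hn => ?_⟩
  obtain ⟨hi, h1⟩ := integral_deriv_smoothTransition_sq (Nat.cast_nonneg (α := ℝ) n)
  rw [integral_radialCutoff_mul_divergence hd _ hF, dist_zero_right]
  calc _ ≤ ∫ r in Set.Ioi (0 : ℝ),
        deriv Real.smoothTransition (r ^ 2 - n) * (2 * r) * (ε / 2) := by
        refine norm_integral_le_of_norm_le (hi.mul_const _) ?_
        filter_upwards [ae_restrict_mem measurableSet_Ioi] with r hr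
        have hr' : (0 : ℝ) < r := hr
        have hm := Real.smoothTransition.monotone.deriv_nonneg (x := r ^ 2 - n)
        rw [norm_mul, Real.norm_of_nonneg (by positivity)]
        rcases le_or_gt (r ^ 2 - n) 0 with h | h
        · simp [deriv_smoothTransition_eq_zero h]
        · have hRr : R ≤ r := by
            have : R ^ 2 ≤ n := Nat.ceil_le.1 hn
            exact (abs_le_of_sq_le_sq' (by linarith) hr'.le).2
          have := (hR r hRr).le
          rw [dist_zero_right] at this
          gcongr
    _ = ε / 2 := by rw [integral_mul_const, h1, one_mul]
    _ < ε := half_lt_self hε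

/-! ### The Stein identity -/

/-- The product rule for the divergence of `q φ`. -/
theorem divergence_smul {d : ℕ} {q : Eucl d → ℝ} {φ : Eucl d → Eucl d} {x : Eucl d}
    (hq : DifferentiableAt ℝ q x) (hφ : DifferentiableAt ℝ φ x) :
    divergence (fun y => q y • φ y) x = q x * divergence φ x + fderiv ℝ q x (φ x) := by
  have hexp : fderiv ℝ q x (φ x)
      = ∑ i : Fin d, fderiv ℝ q x (EuclideanSpace.single i 1) * φ x i := by
    conv_lhs => rw [← (EuclideanSpace.basisFun (Fin d) ℝ).sum_repr (φ x)]
    simp [mul_comm]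
  rw [divergence, fderiv_fun_smul hq hφ, hexp, divergence, Finset.mul_sum,
    ← Finset.sum_add_distrib]
  exact Finset.sum_congr rfl fun i _ => by simp

/-- The Stein operator in divergence form, `q T_q φ = ∇·(q φ)`. It holds also where `q` vanishes:
`q` has a minimum there, so that `∇q = 0` and both sides are `0`. -/
theorem mul_langevinStein {d : ℕ} {q : Eucl d → ℝ} {φ : Eucl d → Eucl d}
    (hq : ContDiff ℝ 1 q) (hq0 : ∀ x, 0 ≤ q x) (hφ : ContDiff ℝ 1 φ) (x : Eucl d) :
    q x * langevinStein q φ x = divergence (fun y => q y • φ y) x := by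
  have hqx := hq.differentiable (by norm_num) x
  rw [divergence_smul hqx (hφ.differentiable (by norm_num) x)]
  rcases (hq0 x).eq_or_lt with h | h
  · have hmin : IsLocalMin q x := Eventually.of_forall fun y => h ▸ hq0 y
    simp [← h, hmin.fderiv_eq_zero]
  · have hlog : fderiv ℝ (fun y => Real.log (q y)) x = (q x)⁻¹ • fderiv ℝ q x :=
      (hqx.hasFDerivAt.log h.ne').fderiv
    rw [langevinStein, gradient, real_inner_comm, InnerProductSpace.toDual_symm_apply, hlog]
    simp only [smul_apply, smul_eq_mul]
    field_simp

theorem continuousOn_langevinStein {d : ℕ} {q : Eucl d → ℝ} {φ : Eucl d → Eucl d}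
    (hq : ContDiff ℝ 1 q) (hq0 : ∀ x, 0 ≤ q x) (hφ : ContDiff ℝ 1 φ) :
    ContinuousOn (langevinStein q φ) (Function.support q) := by
  have h := (continuous_divergence (hq.smul hφ)).continuousOn.div hq.continuous.continuousOn
    (s := Function.support q) fun x hx => hx
  refine h.congr fun x hx => ?_
  rw [Pi.div_apply, eq_div_iff hx, mul_comm]
  exact mul_langevinStein hq hq0 hφ x

theorem integral_densityMeasure {d : ℕ} {q : Eucl d → ℝ} (hq : Measurable q)
    (hq0 : ∀ x, 0 ≤ q x) (f : Eucl d → ℝ) :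
    ∫ x, f x ∂(densityMeasure q) = ∫ x, q x * f x := by
  rw [densityMeasure, integral_withDensity_eq_integral_toReal_smul hq.ennreal_ofReal
    (ae_of_all _ fun _ => ENNReal.ofReal_lt_top)]
  simp [ENNReal.toReal_ofReal (hq0 _)]

theorem integrable_densityMeasure_iff {d : ℕ} {q : Eucl d → ℝ} (hq : Measurable q)
    (hq0 : ∀ x, 0 ≤ q x) {f : Eucl d → ℝ} :
    Integrable f (densityMeasure q) ↔ Integrable (fun x => q x * f x) := by
  rw [densityMeasure, integrable_withDensity_iff_integrable_smul' hq.ennreal_ofReal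
    (ae_of_all _ fun _ => ENNReal.ofReal_lt_top)]
  simp [ENNReal.toReal_ofReal (hq0 _)]

/-- **Stein's identity**: `E_q[T_q φ] = 0` for admissible `φ`. -/
theorem integral_langevinStein_eq_zero {d : ℕ} {q : Eucl d → ℝ} {φ : Eucl d → Eucl d}
    (hq : ContDiff ℝ 1 q) (hq0 : ∀ x, 0 ≤ q x) (hφ : SteinAdmissible q φ) :
    ∫ x, langevinStein q φ x ∂(densityMeasure q) = 0 := by
  have hint := (integrable_densityMeasure_iff hq.continuous.measurable hq0).1 hφ.integrable
  rw [integral_densityMeasure hq.continuous.measurable hq0]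
  simp only [mul_langevinStein hq hq0 hφ.contDiff] at hint ⊢
  exact integral_divergence_eq_zero (hq.smul hφ.contDiff) hint hφ.boundary

/-! ### Zero variance -/

theorem isProbabilityMeasure_densityMeasure {d : ℕ} {q : Eucl d → ℝ} (hq : IsProbDensity q) :
    IsProbabilityMeasure (densityMeasure q) := by
  refine ⟨?_⟩
  rw [densityMeasure, withDensity_apply _ MeasurableSet.univ, Measure.restrict_univ,
    ← ofReal_integral_eq_lintegral_ofReal hq.integrable (ae_of_all _ hq.nonneg),
    hq.integral_eq_one, ENNReal.ofReal_one]

/-- An almost sure property under the law with density `q` that is an equation between functions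
continuous on `{q > 0}` holds at every point of `{q > 0}`, since that set is open. -/
theorem ae_densityMeasure_eq_iff {d : ℕ} {q : Eucl d → ℝ} (hq : Continuous q)
    (hq0 : ∀ x, 0 ≤ q x) {f g : Eucl d → ℝ} (hf : ContinuousOn f (Function.support q))
    (hg : ContinuousOn g (Function.support q)) :
    f =ᵐ[densityMeasure q] g ↔ Set.EqOn f g (Function.support q) := by
  have hsupp : ∀ x, ENNReal.ofReal (q x) ≠ 0 ↔ x ∈ Function.support q := fun x => by
    simp [(hq0 x).lt_iff_ne']
  have hopen : IsOpen (Function.support q) := hq.isOpen_support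
  rw [EventuallyEq, densityMeasure, ae_withDensity_iff hq.measurable.ennreal_ofReal]
  simp only [hsupp]
  refine ⟨fun h => Measure.eqOn_open_of_ae_eq (μ := volume) ?_ hopen hf hg,
    fun h => ae_of_all _ fun x hx => h hx⟩
  exact (ae_restrict_iff' hopen.measurableSet).2 h

/-- The zero-variance criterion for a general `C¹` probability density with finite first moment. -/
theorem totalVariance_add_genLangevinStein_eq_zero_iff {d : ℕ} {q : Eucl d → ℝ}
    (hq : IsProbDensity q) (hC1 : ContDiff ℝ 1 q)
    (hmean : Integrable (fun x : Eucl d => x) (densityMeasure q))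
    {Φ : Eucl d → Matrix (Fin d) (Fin d) ℝ} (hΦ : MatrixSteinAdmissible q Φ) :
    totalVariance (densityMeasure q) (fun x => x + genLangevinStein q Φ x) = 0 ↔
      ∀ x ∈ Function.support q,
        genLangevinStein q Φ x = (∫ y, y ∂(densityMeasure q)) - x := by
  have := isProbabilityMeasure_densityMeasure hq
  have hcoord : ∀ j : Fin d, Integrable (fun x : Eucl d => x j) (densityMeasure q) := fun j =>
    (EuclideanSpace.proj (𝕜 := ℝ) j).integrable_comp hmean
  have hm : ∀ j : Fin d,
      (∫ y : Eucl d, y j ∂(densityMeasure q)) = (∫ y, y ∂(densityMeasure q)) j := fun j =>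
    (EuclideanSpace.proj (𝕜 := ℝ) j).integral_comp_comm hmean
  have key : ∀ j : Fin d,
      evariance (fun x : Eucl d => (x + genLangevinStein q Φ x) j) (densityMeasure q) = 0 ↔
        ∀ x ∈ Function.support q,
          genLangevinStein q Φ x j = (∫ y, y ∂(densityMeasure q)) j - x j := by
    intro j
    have hY : (fun x : Eucl d => (x + genLangevinStein q Φ x) j)
        = fun x => x j + langevinStein q (matrixColumn Φ j) x := rfl
    have hI : Integrable (fun x : Eucl d => x j + langevinStein q (matrixColumn Φ j) x)
        (densityMeasure q) := (hcoord j).add (hΦ j).integrable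
    -- By Stein's identity the estimator is unbiased.
    have hEY : ∫ x, (x j + langevinStein q (matrixColumn Φ j) x) ∂(densityMeasure q)
        = (∫ y, y ∂(densityMeasure q)) j := by
      rw [integral_add (hcoord j) (hΦ j).integrable,
        integral_langevinStein_eq_zero hC1 hq.nonneg (hΦ j), add_zero, hm]
    have hcont : ContinuousOn (fun x : Eucl d => x j + langevinStein q (matrixColumn Φ j) x)
        (Function.support q) :=
      (EuclideanSpace.proj (𝕜 := ℝ) j).continuous.continuousOn.add
        (continuousOn_langevinStein hC1 hq.nonneg (hΦ j).contDiff)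
    rw [hY, evariance_eq_zero_iff hI.aestronglyMeasurable.aemeasurable, hEY,
      ae_densityMeasure_eq_iff hC1.continuous hq.nonneg hcont continuousOn_const]
    exact forall₂_congr fun x _ => eq_sub_iff_add_eq'.symm
  simp only [totalVariance, Finset.sum_eq_zero_iff, Finset.mem_univ, true_imp_iff, key]
  refine ⟨fun h x hx => ?_, fun h j x hx => ?_⟩
  · ext j
    exact h j x hx
  · rw [h x hx]
    rfl

theorem isProbDensity_noisePosterior {d : ℕ} {p₀ p₁ : Eucl d → ℝ} {a b : ℝ} {xt : Eucl d}
    (hp₀ : IsProbDensity p₀) (hp₁ : IsProbDensity p₁)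
    (hfin : Integrable (noiseJoint p₀ p₁ a b xt) volume)
    (hpos : 0 < ∫ x₀, noiseJoint p₀ p₁ a b xt x₀) :
    IsProbDensity (noisePosterior p₀ p₁ a b xt) where
  measurable := by
    have h0 := hp₀.measurable
    have h1 := hp₁.measurable
    unfold noisePosterior noiseJoint
    fun_prop
  nonneg x := div_nonneg (mul_nonneg (hp₀.nonneg _) (hp₁.nonneg _)) hpos.le
  integrable := hfin.div_const _
  integral_eq_one := by
    simp only [noisePosterior]
    rw [integral_div, div_self hpos.ne']

theorem mainTheorem8 {d : ℕ} (p₀ p₁ : Eucl d → ℝ)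
    (hp₀ : IsProbDensity p₀) (hp₁ : IsProbDensity p₁)
    (α β : ℝ → ℝ) (t : ℝ) (hα : α t ≠ 0) (xt : Eucl d)
    -- the posterior given `x_t` exists: its normalizing constant is finite and positive
    (hfin : Integrable (noiseJoint p₀ p₁ (α t) (β t) xt) volume)
    (hpos : 0 < ∫ x₀, noiseJoint p₀ p₁ (α t) (β t) xt x₀)
    -- the posterior density is continuously differentiable and has a mean
    (hC1 : ContDiff ℝ 1 (noisePosterior p₀ p₁ (α t) (β t) xt))
    (hmean : Integrable (fun x₀ : Eucl d => x₀)
      (densityMeasure (noisePosterior p₀ p₁ (α t) (β t) xt)))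
    -- the test function `Φ_t(x₀, x_t)`, written `Φ t x₀ xt`
    (Φ : ℝ → Eucl d → Eucl d → Matrix (Fin d) (Fin d) ℝ)
    (hΦ : MatrixSteinAdmissible (noisePosterior p₀ p₁ (α t) (β t) xt)
      (fun x₀ => Φ t x₀ xt)) :
    totalVariance (densityMeasure (noisePosterior p₀ p₁ (α t) (β t) xt))
        (fun x₀ => x₀ + genLangevinStein (noisePosterior p₀ p₁ (α t) (β t) xt)
          (fun y => Φ t y xt) x₀) = 0 ↔
      ∀ x₀ ∈ Function.support (noisePosterior p₀ p₁ (α t) (β t) xt),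
        genLangevinStein (noisePosterior p₀ p₁ (α t) (β t) xt) (fun y => Φ t y xt) x₀ =
          (∫ y, y ∂(densityMeasure (noisePosterior p₀ p₁ (α t) (β t) xt))) - x₀ := by
  exact totalVariance_add_genLangevinStein_eq_zero_iff
    (isProbDensity_noisePosterior hp₀ hp₁ hfin hpos) hC1 hmean hΦ
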